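/- A predicate is a map $P:\{0,1\}^2\to\{0,1\}$. For a digraph $G=(V,E,w)$ with $E\subseteq V\times V$ and edge weights $w:E\to\mathbb{R}_{\ge 0}$, and for $S\subseteq V$, let $$P_G(S)=\sum_{(v,u)\in E}P(\mathbf 1_S(v),\mathbf 1_S(u))\,w(v,u).$$ Write $x\in(1\pm\epsilon)y$ for $(1-\epsilon)y\le x\le(1+\epsilon)y$. An $\epsilon$-$P$-sparsifier of $G$ is a re-weighted subgraph $H=(V,E_H,w_H)$, with $E_H\subseteq E$ and $w_H:E_H\to\mathbb{R}_{\ge0}$, such that $P_H(S)\in(1\pm\epsilon)P_G(S)$ for all $S\subseteq V$. An $\epsilon$-$P$-sketching scheme for a class $\mathcal C$ of digraphs on the vertex set $V$ is a pair of maps $(\mathrm{sk},\mathrm{est})$, where $\mathrm{sk}$ assigns a bit string $\mathrm{sk}_G$ to a digraph $G$ and $\mathrm{est}$ assigns a real number to a bit string and a subset of $V$, such that $\mathrm{est}(\mathrm{sk}_G,S)\in(1\pm\epsilon)P_G(S)$ for all $G\in\mathcal C$ and $S\subseteq V$. Its sketch size is $\sup_{G\in\mathcal C}|\mathrm{sk}_G|\in\mathbb{N}\cup\{\infty\}$,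 in bits. Theorem. There is an absolute constant $c>0$ such that the following holds for every predicate $P\in\{\mathrm{Cut},\mathrm{unCut},\mathrm{Or},\mathrm{nAnd},\overline{10}\}$ (that is, $P(x,y)=1$ if and only if, respectively, $x\ne y$; $x=y$; $x=1$ or $y=1$; $(x,y)\ne(1,1)$; $(x,y)\neq(1,0)$), every integer $n\ge1$ and every $\epsilon\in(1/\sqrt n,1)$. 1. Let $\mathcal C$ be a class of weighted digraphs on $\{1,\dots,n\}$ that contains all loopless digraphs whose edges all have weight $1$ (for instance the class of all weighted digraphs, or just that of the loopless unit-weight ones). Then every $\epsilon$-$P$-sketching scheme for $\mathcal C$ has sketch size at least $c\,n/\epsilon^2$ bits. 2. There is a digraph $G$ on $n$ vertices, loopless and with all edge weights equal to $1$, such that every $\epsilon$-$P$-sparsifier of $G$ has at least $c\,n/\epsilon^2$ edges. -/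

import Mathlib

open scoped ENNReal

/-- A binary Boolean predicate `P : {0,1}² → {0,1}`. -/
abbrev BoolPred : Type := Bool → Bool → Bool

/-- `Cut(x, y) = 1` iff `x ≠ y`. -/
def predCut : BoolPred := fun x y => x != y

/-- `unCut(x, y) = 1` iff `x = y`. -/
def predUnCut : BoolPred := fun x y => x == y

/-- `Or(x, y) = 1` iff `x = 1` or `y = 1`. -/
def predOr : BoolPred := fun x y => x || y

/-- `nAnd(x, y) = 1` iff `(x, y) ≠ (1, 1)`. -/
def predNAnd : BoolPred := fun x y => !(x && y)

/-- The predicate satisfied by every pair of bits except `(x, y) = (1, 0)`. -/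
def predNot10 : BoolPred := fun x y => !(x && !y)

/-- An edge-weighted digraph `(V, E, w)`: a set `E` of ordered pairs of vertices and a nonnegative
weight for each edge. Pairs outside `E` are given the weight `0`, so that the weight function
carries no information besides the edge weights. -/
structure WDigraph (V : Type*) where
  edges : Finset (V × V)
  weight : V × V → ℝ
  weight_nonneg : ∀ e, 0 ≤ weight e
  weight_eq_zero : ∀ e, e ∉ edges → weight e = 0

namespace WDigraph

variable {V : Type*} [DecidableEq V]

/-- `P_G(S)`: the total weight of the edges `(v, u)` with `P(1_S(v), 1_S(u)) = 1`. -/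
def value (P : BoolPred) (G : WDigraph V) (S : Finset V) : ℝ :=
  ∑ e ∈ G.edges, if P (decide (e.1 ∈ S)) (decide (e.2 ∈ S)) = true then G.weight e else 0

/-- `H` is an `ε`-`P`-sparsifier of `G`: a re-weighted subgraph of `G` on the same vertex set, with
`P_H(S) ∈ (1 ± ε) · P_G(S)` for every vertex subset `S`. -/
def IsSparsifier (P : BoolPred) (ε : ℝ) (G H : WDigraph V) : Prop :=
  H.edges ⊆ G.edges ∧
    ∀ S : Finset V, H.value P S ∈ Set.Icc ((1 - ε) * G.value P S) ((1 + ε) * G.value P S)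

/-- The digraphs without loops in which every edge has weight `1`. -/
def simpleUnweighted (V : Type*) : Set (WDigraph V) :=
  {G | ∀ e ∈ G.edges, e.1 ≠ e.2 ∧ G.weight e = 1}

end WDigraph

/-- A (deterministic) sketching scheme on the variable set `V`: the map `sk` encodes a digraph by a
bit string, and `est` estimates the value of a vertex subset from the bit string alone. -/
structure SketchingScheme (V : Type*) where
  sk : WDigraph V → List Bool
  est : List Bool → Finset V → ℝ

namespace SketchingScheme

variable {V : Type*}

/-- The scheme is an `ε`-`P`-sketching scheme for the class `C` of digraphs:
`est(sk_G, S) ∈ (1 ± ε) · P_G(S)` for every `G` in `C` and every vertex subset `S`. For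
`C = Set.univ` it is an `ε`-`P`-sketching scheme for all weighted digraphs. -/
def IsSketchFor [DecidableEq V] (P : BoolPred) (ε : ℝ) (C : Set (WDigraph V))
    (A : SketchingScheme V) : Prop :=
  ∀ G ∈ C, ∀ S : Finset V,
    A.est (A.sk G) S ∈ Set.Icc ((1 - ε) * G.value P S) ((1 + ε) * G.value P S)

/-- The sketch size on the class `C`, in bits: the maximal length of the encoding of a digraph in
`C` (infinite if these lengths are unbounded). -/
noncomputable def size (C : Set (WDigraph V)) (A : SketchingScheme V) : ℕ∞ :=
  ⨆ G ∈ C, ((A.sk G).length : ℕ∞)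

end SketchingScheme

/-! The hard graphs are disjoint unions of bipartite blocks with sides of size k of order 1/ε²,
about n/(2k) of them. Each predicate is 0 at some pair of bits; labelling all other blocks by it
isolates one block, so the error is at most ε k² (`value_blockSet`). Each predicate also has a
nonzero xy Fourier coefficient: an alternating sum of four block values is a signed bilinear form in
the weight matrix (`blockSum_alternating`). If two block matrices have close values, their
difference D thus has ∞ → 1 norm O(ε k²). By Khintchine that norm is at least 4/9 times the sum of
the row norms of D, so for small ε √k at most k²/8 entries differ between 0 and 1
(`card_mismatch_le`). Hence graphs with equal sketches lie within Hamming distance N/8, where N = b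
k² counts the possible edges of b blocks, and volume counting forces N/4 bits. Likewise a sparsifier
of the complete blocks drops at most N/8 edges. Finally N is of order n/ε². -/

/-! ### Rademacher sums and the ∞ → 1 norm -/

/-- The sign `±1` of a bit. -/
def boolSign (b : Bool) : ℝ := if b then 1 else -1

/-- The Rademacher sum `∑ aⱼ yⱼ` at the sign vector `y`. -/
def signSum {k : ℕ} (a : Fin k → ℝ) (y : Fin k → Bool) : ℝ := ∑ j, a j * boolSign (y j)

/-- Splitting off the first sign gives the induction step for both moments below. -/
theorem sum_signSum_succ {k : ℕ} (a : Fin (k + 1) → ℝ) (f : ℝ → ℝ) :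
    ∑ y, f (signSum a y) =
      ∑ y, (f (signSum (Fin.tail a) y + a 0) + f (signSum (Fin.tail a) y - a 0)) := by
  rw [← (Fin.consEquiv fun _ => Bool).sum_comp, Fintype.sum_prod_type, Fintype.sum_bool,
    ← Finset.sum_add_distrib]
  refine Finset.sum_congr rfl fun y _ => ?_
  congr 2 <;> simp [signSum, Fin.sum_univ_succ, Fin.consEquiv, boolSign, Fin.tail] <;> ring

theorem sum_signSum_sq {k : ℕ} (a : Fin k → ℝ) :
    ∑ y, signSum a y ^ 2 = 2 ^ k * ∑ j, a j ^ 2 := by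
  induction k with
  | zero => simp [signSum]
  | succ k ih =>
    rw [sum_signSum_succ a (· ^ 2), Fin.sum_univ_succ]
    have h := ih (Fin.tail a)
    have : ∀ y : Fin k → Bool, (signSum (Fin.tail a) y + a 0) ^ 2 + (signSum (Fin.tail a) y - a 0) ^ 2
        = 2 * signSum (Fin.tail a) y ^ 2 + 2 * a 0 ^ 2 := fun y => by ring
    simp only [this, Finset.sum_add_distrib, ← Finset.mul_sum, h]
    simp [Fin.tail]
    ring

theorem sum_signSum_pow_four_le {k : ℕ} (a : Fin k → ℝ) :
    ∑ y, signSum a y ^ 4 ≤ 2 ^ k * (3 * (∑ j, a j ^ 2) ^ 2) := by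
  induction k with
  | zero => simp [signSum]
  | succ k ih =>
    rw [sum_signSum_succ a (· ^ 4), Fin.sum_univ_succ]
    have h := ih (Fin.tail a)
    have h2 := sum_signSum_sq (Fin.tail a)
    have : ∀ y : Fin k → Bool, (signSum (Fin.tail a) y + a 0) ^ 4 + (signSum (Fin.tail a) y - a 0) ^ 4
        = 2 * signSum (Fin.tail a) y ^ 4 + 12 * a 0 ^ 2 * signSum (Fin.tail a) y ^ 2
          + 2 * a 0 ^ 4 := fun y => by ring
    simp only [this, Finset.sum_add_distrib, ← Finset.mul_sum, h2]
    change _ ≤ 2 ^ k * (3 * (∑ i : Fin k, a i.succ ^ 2) ^ 2) at h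
    change _ + 12 * a 0 ^ 2 * (2 ^ k * ∑ i : Fin k, a i.succ ^ 2) + _ ≤ _
    generalize ∑ i : Fin k, a i.succ ^ 2 = s at h ⊢
    -- The a₀² s terms agree exactly; the only slack is in a₀⁴, with coefficient 2 against 6.
    have hk : (0 : ℝ) ≤ 2 ^ k * a 0 ^ 4 := by positivity
    simp only [Finset.sum_const, Finset.card_univ, Fintype.card_pi, Fintype.card_bool,
      Finset.prod_const, Fintype.card_fin, nsmul_eq_mul, Nat.cast_pow, Nat.cast_ofNat]
    rw [pow_succ 2 k]
    linarith

/-- Khintchine's inequality between the first and the second moment. -/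
theorem khintchine_l1 {k : ℕ} (a : Fin k → ℝ) :
    2 ^ k * (4 / 9 * √(∑ j, a j ^ 2)) ≤ ∑ y, |signSum a y| := by
  set s := ∑ j, a j ^ 2 with hs
  have hs0 : 0 ≤ s := Finset.sum_nonneg fun j _ => sq_nonneg _
  rcases hs0.eq_or_lt with h0 | hpos
  · rw [← h0]
    simpa using Finset.sum_nonneg fun y _ => abs_nonneg (signSum a y)
  set r := √s
  have hr : 0 < r := Real.sqrt_pos.2 hpos
  have hrs : r ^ 2 = s := Real.sq_sqrt hs0
  -- This is 2(x - x³) ≤ 1 at x = |t|/(3r), times |t|. The scale 1/(3r) maximises α s - 3α³ s², the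
  -- bound after averaging, and yields 4/9.
  have key : ∀ t : ℝ, 2 * (1 / (3 * r) * t ^ 2 - (1 / (3 * r)) ^ 3 * t ^ 4) ≤ |t| := by
    intro t
    have ht : t ^ 2 = |t| ^ 2 := (sq_abs t).symm
    have ht4 : t ^ 4 = |t| ^ 4 := by rw [show t ^ 4 = (t ^ 2) ^ 2 by ring, ht]; ring
    rw [ht, ht4]
    have hu0 := abs_nonneg t
    set u := |t|
    have hx : 0 ≤ 1 / (3 * r) * u := by positivity
    have hcub : 2 * (1 / (3 * r) * u - (1 / (3 * r) * u) ^ 3) ≤ 1 := by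
      set x := 1 / (3 * r) * u
      nlinarith [mul_nonneg hx (sq_nonneg (x - 1 / 2)), sq_nonneg (x - 1 / 2),
        sq_nonneg (x - 3 / 5), mul_nonneg hx (sq_nonneg (x - 3 / 5))]
    calc _ = 2 * (1 / (3 * r) * u - (1 / (3 * r) * u) ^ 3) * u := by ring
      _ ≤ 1 * u := mul_le_mul_of_nonneg_right hcub hu0
      _ = u := one_mul u
  calc 2 ^ k * (4 / 9 * r)
      = 2 * (1 / (3 * r) * (2 ^ k * s) - (1 / (3 * r)) ^ 3 * (2 ^ k * (3 * s ^ 2))) := by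
        rw [← hrs]; field_simp; ring
    _ ≤ 2 * (1 / (3 * r) * ∑ y, signSum a y ^ 2 - (1 / (3 * r)) ^ 3 * ∑ y, signSum a y ^ 4) := by
        rw [sum_signSum_sq]
        have := mul_le_mul_of_nonneg_left (sum_signSum_pow_four_le a)
          (by positivity : 0 ≤ (1 / (3 * r)) ^ 3)
        linarith
    _ = ∑ y, 2 * (1 / (3 * r) * signSum a y ^ 2 - (1 / (3 * r)) ^ 3 * signSum a y ^ 4) := by
        rw [← Finset.mul_sum, Finset.sum_sub_distrib, ← Finset.mul_sum, ← Finset.mul_sum]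
    _ ≤ _ := Finset.sum_le_sum fun y _ => key _

/-- A lower bound for the `∞ → 1` norm of a matrix by its row norms. -/
theorem exists_signs_bilinear_ge {k : ℕ} (D : Fin k → Fin k → ℝ) :
    ∃ x y : Fin k → Bool, 4 / 9 * ∑ i, √(∑ j, D i j ^ 2) ≤
      ∑ i, ∑ j, D i j * (boolSign (x i) * boolSign (y j)) := by
  have havg : ∑ _y : Fin k → Bool, 4 / 9 * ∑ i, √(∑ j, D i j ^ 2) ≤
      ∑ y, ∑ i, |signSum (D i) y| := by
    rw [Finset.sum_comm]
    simp only [Finset.sum_const, Finset.card_univ, Fintype.card_pi, Fintype.card_bool,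
      Finset.prod_const, Fintype.card_fin, nsmul_eq_mul, Nat.cast_pow, Nat.cast_ofNat]
    rw [Finset.mul_sum, Finset.mul_sum]
    exact Finset.sum_le_sum fun i _ => khintchine_l1 (D i)
  obtain ⟨y, -, hy⟩ := Finset.exists_le_of_sum_le Finset.univ_nonempty havg
  -- Taking x as the signs of the row sums turns the bilinear form into the sum of their absolute
  -- values.
  refine ⟨fun i => decide (0 ≤ signSum (D i) y), y, hy.trans (le_of_eq ?_)⟩
  refine Finset.sum_congr rfl fun i _ => ?_
  have : ∑ j, D i j * (boolSign (decide (0 ≤ signSum (D i) y)) * boolSign (y j)) =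
      boolSign (decide (0 ≤ signSum (D i) y)) * signSum (D i) y := by
    rw [signSum, Finset.mul_sum]
    exact Finset.sum_congr rfl fun j _ => by ring
  rw [this]
  by_cases h : 0 ≤ signSum (D i) y
  · simp [boolSign, h, abs_of_nonneg]
  · simp [boolSign, h, abs_of_neg (not_le.1 h)]

/-- A matrix whose `∞ → 1` norm is small has few large entries. -/
theorem card_large_le {k : ℕ} (D : Fin k → Fin k → ℝ) {B : ℝ}
    (hB : ∀ x y : Fin k → Bool, ∑ i, ∑ j, D i j * (boolSign (x i) * boolSign (y j)) ≤ B)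
    (T : Finset (Fin k × Fin k)) (hT : ∀ p ∈ T, |D p.1 p.2| = 1) :
    4 / 9 * (T.card : ℝ) ≤ √k * B := by
  obtain ⟨x, y, hxy⟩ := exists_signs_bilinear_ge D
  have hcard : (T.card : ℝ) = ∑ i, ∑ j, if (i, j) ∈ T then (1 : ℝ) else 0 := by
    rw [← Fintype.sum_prod_type']
    simp
  -- Cauchy–Schwarz on a row. Entries outside T are arbitrary and only enlarge the right side, so a
  -- sparsifier may reweight the edges it keeps.
  have hrow : ∀ i, ∑ j, (if (i, j) ∈ T then (1 : ℝ) else 0) ≤ √k * √(∑ j, D i j ^ 2) := by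
    intro i
    have h1 : ∑ j, (if (i, j) ∈ T then (1 : ℝ) else 0) ≤ ∑ j, 1 * |D i j| := by
      refine Finset.sum_le_sum fun j _ => ?_
      split_ifs with h
      · simpa using (hT _ h).ge
      · simp
    refine h1.trans ((Real.sum_mul_le_sqrt_mul_sqrt _ _ _).trans (le_of_eq ?_))
    simp
  calc 4 / 9 * (T.card : ℝ) ≤ 4 / 9 * ∑ i, √k * √(∑ j, D i j ^ 2) := by
        rw [hcard]
        exact mul_le_mul_of_nonneg_left (Finset.sum_le_sum fun i _ => hrow i) (by norm_num)
    _ = √k * (4 / 9 * ∑ i, √(∑ j, D i j ^ 2)) := by rw [← Finset.mul_sum]; ring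
    _ ≤ √k * B := mul_le_mul_of_nonneg_left (hxy.trans (hB x y)) (Real.sqrt_nonneg _)

/-! ### Volume counting in the cube -/

/-- A Hamming ball of radius `N / 8` in the cube of dimension `N`. -/
theorem card_hamming_ball_le {α : Type*} [Fintype α] [DecidableEq α]
    (F : Finset (Finset α)) (hF : ∀ M ∈ F, 8 * M.card ≤ Fintype.card α) :
    (F.card : ℝ) * (3 / 4) ^ Fintype.card α ≤ (1 + (3 / 4) ^ 8) ^ Fintype.card α := by
  calc (F.card : ℝ) * (3 / 4) ^ Fintype.card α = ∑ M ∈ F, (3 / 4 : ℝ) ^ Fintype.card α := by simp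
    _ ≤ ∑ M ∈ F, ((3 / 4 : ℝ) ^ 8) ^ M.card := by
        refine Finset.sum_le_sum fun M hM => ?_
        rw [← pow_mul]
        exact pow_le_pow_of_le_one (by norm_num) (by norm_num) (hF M hM)
    _ ≤ ∑ M : Finset α, ((3 / 4 : ℝ) ^ 8) ^ M.card :=
        Finset.sum_le_sum_of_subset_of_nonneg (Finset.subset_univ _) fun _ _ _ => by positivity
    _ = (1 + (3 / 4) ^ 8) ^ Fintype.card α := by
        have := Finset.sum_pow_mul_eq_add_pow ((3 / 4 : ℝ) ^ 8) 1 (Finset.univ : Finset α)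
        simp only [one_pow, mul_one, Finset.powerset_univ, Finset.card_univ] at this
        rw [this, add_comm]

/-- A labelling of the subsets of an `N`-set by strings of length at most `s`, all of whose fibres
have Hamming diameter at most `N / 8`, has `s ≥ N / 4`. -/
theorem card_le_four_mul_of_fibres {α : Type*} [Fintype α] [DecidableEq α]
    (f : Finset α → List Bool) (s : ℕ) (hs : ∀ M, (f M).length ≤ s)
    (hf : ∀ M M', f M = f M' → 8 * (symmDiff M M').card ≤ Fintype.card α) :
    Fintype.card α ≤ 4 * s := by
  set N := Fintype.card α
  -- Reading `none` past the end encodes strings of length at most s injectively, with 3 ^ s codes.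
  let g : Finset α → (Fin s → Option Bool) := fun M i => (f M)[(i : ℕ)]?
  have hg : ∀ M M', g M = g M' → f M = f M' := by
    intro M M' h
    refine List.ext_getElem? fun i => ?_
    by_cases hi : i < s
    · exact congrFun h ⟨i, hi⟩
    · rw [List.getElem?_eq_none ((hs M).trans (not_lt.1 hi)),
        List.getElem?_eq_none ((hs M').trans (not_lt.1 hi))]
  have hfib : ∀ c, ((Finset.univ.filter fun M => g M = c).card : ℝ) * (3 / 4) ^ N ≤
      (1 + (3 / 4) ^ 8) ^ N := by
    intro c
    rcases (Finset.univ.filter fun M => g M = c).eq_empty_or_nonempty with h | ⟨M₀, h₀⟩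
    · rw [h]; simp only [Finset.card_empty, Nat.cast_zero, zero_mul]; positivity
    have hinj : Function.Injective (symmDiff M₀) := symmDiff_right_injective M₀
    rw [← Finset.card_image_of_injective _ hinj]
    refine card_hamming_ball_le _ fun D hD => ?_
    obtain ⟨M, hM, rfl⟩ := Finset.mem_image.1 hD
    exact hf _ _ (hg _ _ (by
      rw [(Finset.mem_filter.1 h₀).2, (Finset.mem_filter.1 hM).2]))
  have htot : (2 : ℝ) ^ N = ∑ c, ((Finset.univ.filter fun M => g M = c).card : ℝ) := by
    have := Finset.card_eq_sum_card_fiberwise (f := g) (s := Finset.univ) (t := Finset.univ)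
      (fun _ _ => Finset.mem_coe.2 (Finset.mem_univ _))
    rw [Finset.card_univ, Fintype.card_finset] at this
    exact_mod_cast this
  have hmain : (2 : ℝ) ^ N * (3 / 4) ^ N ≤ 3 ^ s * (1 + (3 / 4) ^ 8) ^ N := by
    rw [htot, Finset.sum_mul]
    refine (Finset.sum_le_sum fun c _ => hfib c).trans (le_of_eq ?_)
    simp
  by_contra hlt
  have hlt : 4 * s < N := not_le.1 hlt
  -- If 4s < N, then 3^(4s) ≤ 3^N, so fourth powers compare bases: 1.5⁴ ≈ 5.06 exceeds 3(1 +
  -- (3/4)⁸)⁴ ≈ 4.39.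
  have h1 : ((2 * (3 / 4) : ℝ) ^ 4) ^ N ≤ (3 * (1 + (3 / 4) ^ 8) ^ 4) ^ N := by
    have h4 := pow_le_pow_left₀ (by positivity) hmain 4
    calc ((2 * (3 / 4) : ℝ) ^ 4) ^ N = (2 ^ N * (3 / 4) ^ N) ^ 4 := by
          rw [← mul_pow, ← pow_mul, ← pow_mul, mul_comm 4]
      _ ≤ _ := h4
      _ = 3 ^ (4 * s) * ((1 + (3 / 4) ^ 8) ^ 4) ^ N := by
        rw [mul_pow, ← pow_mul, mul_comm s 4, ← pow_mul, ← pow_mul, mul_comm N 4]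
      _ ≤ 3 ^ N * ((1 + (3 / 4) ^ 8) ^ 4) ^ N := by
        gcongr
        norm_num
      _ = _ := (mul_pow _ _ _).symm
  have h2 : (3 * (1 + (3 / 4) ^ 8) ^ 4 : ℝ) ^ N < ((2 * (3 / 4) : ℝ) ^ 4) ^ N :=
    pow_lt_pow_left₀ (by norm_num) (by positivity) (by omega)
  exact absurd h1 (not_le.2 h2)

/-! ### Predicates and values of a single block -/

/-- A predicate with both values whose degree-two Fourier coefficient is at least `1 / 4`. -/
def HasBilinearPart (P : BoolPred) : Prop :=
  (∃ x y, P x y = false) ∧ (∃ x y, P x y = true) ∧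
    ∃ d : ℝ, 1 ≤ |d| ∧ ∀ x y, (if P x y then (1 : ℝ) else 0) - (if P (!x) y then 1 else 0) -
      (if P x (!y) then 1 else 0) + (if P (!x) (!y) then 1 else 0) = d * (boolSign x * boolSign y)

theorem hasBilinearPart_of_mem {P : BoolPred}
    (hP : P ∈ ({predCut, predUnCut, predOr, predNAnd, predNot10} : Set BoolPred)) :
    HasBilinearPart P := by
  simp only [Set.mem_insert_iff, Set.mem_singleton_iff] at hP
  rcases hP with rfl | rfl | rfl | rfl | rfl
  · refine ⟨by decide, by decide, -2, by norm_num, ?_⟩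
    rintro (_ | _) (_ | _) <;> norm_num [predCut, boolSign]
  · refine ⟨by decide, by decide, 2, by norm_num, ?_⟩
    rintro (_ | _) (_ | _) <;> norm_num [predUnCut, boolSign]
  · refine ⟨by decide, by decide, -1, by norm_num, ?_⟩
    rintro (_ | _) (_ | _) <;> norm_num [predOr, boolSign]
  · refine ⟨by decide, by decide, -1, by norm_num, ?_⟩
    rintro (_ | _) (_ | _) <;> norm_num [predNAnd, boolSign]
  · refine ⟨by decide, by decide, 1, by norm_num, ?_⟩
    rintro (_ | _) (_ | _) <;> norm_num [predNot10, boolSign]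

/-- The value of a bipartite graph with weight matrix `W` on the labelling `x`, `y` of its sides. -/
def blockSum (P : BoolPred) {k : ℕ} (W : Fin k → Fin k → ℝ) (x y : Fin k → Bool) : ℝ :=
  ∑ i, ∑ j, if P (x i) (y j) then W i j else 0

/-- Flipping each side with alternating signs cancels the constant and linear Fourier terms of P. -/
theorem blockSum_alternating {P : BoolPred} {d : ℝ}
    (hd : ∀ x y, (if P x y then (1 : ℝ) else 0) - (if P (!x) y then 1 else 0) -
      (if P x (!y) then 1 else 0) + (if P (!x) (!y) then 1 else 0) = d * (boolSign x * boolSign y))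
    {k : ℕ} (W : Fin k → Fin k → ℝ) (x y : Fin k → Bool) :
    blockSum P W x y - blockSum P W (fun i => !x i) y - blockSum P W x (fun j => !y j) +
      blockSum P W (fun i => !x i) (fun j => !y j) =
      d * ∑ i, ∑ j, W i j * (boolSign (x i) * boolSign (y j)) := by
  simp only [blockSum, Finset.mul_sum, ← Finset.sum_sub_distrib, ← Finset.sum_add_distrib]
  refine Finset.sum_congr rfl fun i _ => Finset.sum_congr rfl fun j _ => ?_
  have h := congrArg (W i j * ·) (hd (x i) (y j))
  simp only [mul_add, mul_sub, mul_ite, mul_one, mul_zero] at h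
  rw [h]
  ring

theorem blockSum_nonneg {P : BoolPred} {k : ℕ} {W : Fin k → Fin k → ℝ} (hW : ∀ i j, 0 ≤ W i j)
    (x y : Fin k → Bool) : 0 ≤ blockSum P W x y := by
  refine Finset.sum_nonneg fun i _ => Finset.sum_nonneg fun j _ => ?_
  split_ifs
  exacts [hW i j, le_rfl]

theorem blockSum_le_sq {P : BoolPred} {k : ℕ} {W : Fin k → Fin k → ℝ} (hW : ∀ i j, W i j ≤ 1)
    (x y : Fin k → Bool) : blockSum P W x y ≤ (k : ℝ) ^ 2 := by
  calc blockSum P W x y ≤ ∑ _i : Fin k, ∑ _j : Fin k, (1 : ℝ) := by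
        refine Finset.sum_le_sum fun i _ => Finset.sum_le_sum fun j _ => ?_
        split_ifs
        exacts [hW i j, zero_le_one]
    _ = (k : ℝ) ^ 2 := by simp [sq]

/-- Two weight matrices with similar block values disagree between `0` and `1` on few entries. -/
theorem card_mismatch_le {P : BoolPred} (hP : HasBilinearPart P) {k : ℕ} {ε : ℝ}
    (hk : ε * √k ≤ 1 / 144 ∨ k = 1) (W W' : Fin k → Fin k → ℝ)
    (h : ∀ x y, |blockSum P W x y - blockSum P W' x y| ≤ 2 * (ε * (k : ℝ) ^ 2))
    (h₀ : ∀ x y, blockSum P W x y = 0 ↔ blockSum P W' x y = 0)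
    (T : Finset (Fin k × Fin k))
    (hT : ∀ p ∈ T, (W p.1 p.2 = 0 ∧ W' p.1 p.2 = 1) ∨ (W p.1 p.2 = 1 ∧ W' p.1 p.2 = 0)) :
    8 * T.card ≤ k ^ 2 := by
  obtain ⟨-, ⟨x₁, y₁, h₁⟩, d, hd1, hd⟩ := hP
  rcases hk with hk | rfl
  -- Four values, each off by 2εk², give B = 8εk². Then |T| ≤ 18 ε√k · k², and 18/144 = 1/8.
  · have key := card_large_le (fun i j => W i j - W' i j) (B := 8 * (ε * (k : ℝ) ^ 2)) ?_ T ?_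
    · have : √k * (8 * (ε * (k : ℝ) ^ 2)) ≤ 8 * (1 / 144) * (k : ℝ) ^ 2 := by
        calc √k * (8 * (ε * (k : ℝ) ^ 2)) = 8 * (ε * √k) * (k : ℝ) ^ 2 := by ring
          _ ≤ _ := by gcongr
      have : (8 * T.card : ℝ) ≤ (k : ℝ) ^ 2 := by linarith
      exact_mod_cast this
    · intro x y
      have e := blockSum_alternating hd W x y
      have e' := blockSum_alternating hd W' x y
      have hb : |d * ∑ i, ∑ j, (W i j - W' i j) * (boolSign (x i) * boolSign (y j))| ≤
          8 * (ε * (k : ℝ) ^ 2) := by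
        simp only [sub_mul, Finset.sum_sub_distrib, mul_sub]
        rw [← e, ← e']
        have a := abs_le.1 (h x y)
        have b := abs_le.1 (h (fun i => !x i) y)
        have c := abs_le.1 (h x (fun j => !y j))
        have d := abs_le.1 (h (fun i => !x i) (fun j => !y j))
        exact abs_le.2 ⟨by linarith [a.1, b.2, c.2, d.1], by linarith [a.2, b.1, c.1, d.2]⟩
      rw [abs_mul] at hb
      exact (le_abs_self _).trans ((le_mul_of_one_le_left (abs_nonneg _) hd1).trans hb)
    · intro p hp
      rcases hT p hp with ⟨a, b⟩ | ⟨a, b⟩ <;> simp [a, b]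
  -- For k = 1 the block is one entry, and a label satisfying P detects whether it is zero.
  · rcases T.eq_empty_or_nonempty with rfl | ⟨p, hp⟩
    · simp
    exfalso
    have := h₀ (fun _ => x₁) (fun _ => y₁)
    simp only [blockSum, h₁, Finset.univ_unique, Finset.sum_singleton, if_true] at this
    have e : (default : Fin 1 × Fin 1) = p := Subsingleton.elim _ _
    change W (default : Fin 1 × Fin 1).1 (default : Fin 1 × Fin 1).2 = 0 ↔
      W' (default : Fin 1 × Fin 1).1 (default : Fin 1 × Fin 1).2 = 0 at this
    rw [e] at this
    rcases hT p hp with ⟨a, b⟩ | ⟨a, b⟩ <;> simp [a, b] at this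

theorem card_le_of_card_fibres_le {β γ : Type*} [Fintype β] [Fintype γ] [DecidableEq β]
    [DecidableEq γ] (D : Finset (β × γ)) (m : ℕ)
    (h : ∀ t, 8 * (Finset.univ.filter fun q => (t, q) ∈ D).card ≤ m) :
    8 * D.card ≤ Fintype.card β * m := by
  have hD : D.card = ∑ t, (Finset.univ.filter fun q => (t, q) ∈ D).card := by
    simp only [Finset.card_filter]
    rw [← Fintype.sum_prod_type', ← Finset.card_filter]
    simp
  rw [hD, Finset.mul_sum]
  simpa using Finset.sum_le_sum fun t (_ : t ∈ Finset.univ) => h t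

/-! ### Disjoint unions of blocks -/

section Blocks

variable {β V : Type*} {k : ℕ}

/-- The position in `V × V` of the entry `(i, j)` of the block `t`. -/
def blockEdge (φ : (β × Fin k) ⊕ (β × Fin k) ↪ V) : β × Fin k × Fin k ↪ V × V where
  toFun p := (φ (.inl (p.1, p.2.1)), φ (.inr (p.1, p.2.2)))
  inj' := by
    rintro ⟨t, i, j⟩ ⟨t', i', j'⟩ h
    simp only [Prod.mk.injEq, EmbeddingLike.apply_eq_iff_eq, Sum.inl.injEq, Sum.inr.injEq] at h ⊢
    exact ⟨h.1.1, h.1.2, h.2.2⟩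

theorem blockEdge_apply (φ : (β × Fin k) ⊕ (β × Fin k) ↪ V) (p : β × Fin k × Fin k) :
    blockEdge φ p = (φ (.inl (p.1, p.2.1)), φ (.inr (p.1, p.2.2))) := rfl

/-- The unit-weight digraph with edge set `M`, a disjoint union of bipartite blocks. -/
def blockGraph [DecidableEq V]
    (φ : (β × Fin k) ⊕ (β × Fin k) ↪ V) (M : Finset (β × Fin k × Fin k)) :
    WDigraph V where
  edges := M.map (blockEdge φ)
  weight e := if e ∈ M.map (blockEdge φ) then 1 else 0
  weight_nonneg e := by split_ifs <;> norm_num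
  weight_eq_zero e he := if_neg he

theorem blockGraph_mem_simpleUnweighted [DecidableEq V]
    (φ : (β × Fin k) ⊕ (β × Fin k) ↪ V)
    (M : Finset (β × Fin k × Fin k)) : blockGraph φ M ∈ WDigraph.simpleUnweighted V := by
  intro e he
  refine ⟨?_, if_pos he⟩
  obtain ⟨p, -, rfl⟩ := Finset.mem_map.1 he
  simp [blockEdge_apply]

theorem blockGraph_weight [DecidableEq β] [DecidableEq V]
    (φ : (β × Fin k) ⊕ (β × Fin k) ↪ V) (M : Finset (β × Fin k × Fin k))
    (p : β × Fin k × Fin k) : (blockGraph φ M).weight (blockEdge φ p) = if p ∈ M then 1 else 0 := by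
  simp only [blockGraph, Finset.mem_map']

/-- The vertex set labelling the block `t` by `x`, `y` and all other blocks by `x₀`, `y₀`. -/
def blockSet [Fintype β] [DecidableEq β]
    (φ : (β × Fin k) ⊕ (β × Fin k) ↪ V) (t : β) (x y : Fin k → Bool) (x₀ y₀ : Bool) :
    Finset V :=
  (Finset.univ.filter fun a => Sum.elim (fun p : β × Fin k => if p.1 = t then x p.2 else x₀)
    (fun p : β × Fin k => if p.1 = t then y p.2 else y₀) a = true).map φ

theorem mem_blockSet_inl [Fintype β] [DecidableEq β]
    (φ : (β × Fin k) ⊕ (β × Fin k) ↪ V) (t : β) (x y : Fin k → Bool)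
    (x₀ y₀ : Bool) (p : β × Fin k) :
    φ (.inl p) ∈ blockSet φ t x y x₀ y₀ ↔ (if p.1 = t then x p.2 else x₀) = true := by
  rw [blockSet, Finset.mem_map']
  simp

theorem mem_blockSet_inr [Fintype β] [DecidableEq β]
    (φ : (β × Fin k) ⊕ (β × Fin k) ↪ V) (t : β) (x y : Fin k → Bool)
    (x₀ y₀ : Bool) (p : β × Fin k) :
    φ (.inr p) ∈ blockSet φ t x y x₀ y₀ ↔ (if p.1 = t then y p.2 else y₀) = true := by
  rw [blockSet, Finset.mem_map']
  simp

/-- Edges of every other block see the pair (x₀, y₀), where P vanishes. -/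
theorem value_blockSet [Fintype β] [DecidableEq β] [DecidableEq V]
    (φ : (β × Fin k) ⊕ (β × Fin k) ↪ V) {P : BoolPred} {x₀ y₀ : Bool}
    (h₀ : P x₀ y₀ = false) {H : WDigraph V} (hH : H.edges ⊆ Finset.univ.map (blockEdge φ))
    (t : β) (x y : Fin k → Bool) :
    H.value P (blockSet φ t x y x₀ y₀) =
      blockSum P (fun i j => H.weight (blockEdge φ (t, i, j))) x y := by
  rw [WDigraph.value, Finset.sum_subset hH, Finset.sum_map, Fintype.sum_prod_type,
    Finset.sum_eq_single t, Fintype.sum_prod_type]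
  · simp [blockSum, mem_blockSet_inl, mem_blockSet_inr, blockEdge_apply]
  · intro s _ hs
    refine Finset.sum_eq_zero fun p _ => ?_
    simp [mem_blockSet_inl, mem_blockSet_inr, blockEdge_apply, hs, h₀]
  · simp
  · intro e _ he
    rw [H.weight_eq_zero e he, ite_self]

/-- A sketching scheme that is correct on all unions of `|β|` bipartite blocks with sides of size
`k` needs a quarter of a bit for each possible edge. -/
theorem card_block_le_four_mul_sketch [Fintype β] [DecidableEq β] [DecidableEq V]
    (φ : (β × Fin k) ⊕ (β × Fin k) ↪ V) {P : BoolPred}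
    (hP : HasBilinearPart P) {ε : ℝ} (hε0 : 0 < ε) (hε1 : ε < 1)
    (hk : ε * √k ≤ 1 / 144 ∨ k = 1) (A : SketchingScheme V)
    (hA : A.IsSketchFor P ε (WDigraph.simpleUnweighted V)) (s : ℕ)
    (hs : ∀ G ∈ WDigraph.simpleUnweighted V, (A.sk G).length ≤ s) :
    Fintype.card β * k ^ 2 ≤ 4 * s := by
  have hcard : Fintype.card (β × Fin k × Fin k) = Fintype.card β * k ^ 2 := by simp [sq]
  rw [← hcard]
  refine card_le_four_mul_of_fibres (fun M => A.sk (blockGraph φ M)) s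
    (fun M => hs _ (blockGraph_mem_simpleUnweighted φ M)) fun M M' hMM => ?_
  rw [hcard]
  refine card_le_of_card_fibres_le _ _ fun t => ?_
  obtain ⟨x₀, y₀, h₀⟩ := hP.1
  have hv : ∀ (M : Finset (β × Fin k × Fin k)) x y, A.est (A.sk (blockGraph φ M))
      (blockSet φ t x y x₀ y₀) ∈ Set.Icc
        ((1 - ε) * blockSum P (fun i j => if (t, i, j) ∈ M then 1 else 0) x y)
        ((1 + ε) * blockSum P (fun i j => if (t, i, j) ∈ M then 1 else 0) x y) := by
    intro M x y
    have := hA _ (blockGraph_mem_simpleUnweighted φ M) (blockSet φ t x y x₀ y₀)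
    rw [value_blockSet φ h₀ (Finset.map_subset_map.2 (Finset.subset_univ _))] at this
    simpa only [blockGraph_weight] using this
  have hn : ∀ (M : Finset (β × Fin k × Fin k)) x y,
      0 ≤ blockSum P (fun i j => if (t, i, j) ∈ M then 1 else 0) x y :=
    fun M => blockSum_nonneg fun i j => by split_ifs <;> norm_num
  have hl : ∀ (M : Finset (β × Fin k × Fin k)) x y,
      blockSum P (fun i j => if (t, i, j) ∈ M then 1 else 0) x y ≤ (k : ℝ) ^ 2 :=
    fun M => blockSum_le_sq fun i j => by split_ifs <;> norm_num
  have hz : ∀ (M M' : Finset (β × Fin k × Fin k)) x y,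
      A.sk (blockGraph φ M) = A.sk (blockGraph φ M') →
      blockSum P (fun i j => if (t, i, j) ∈ M then 1 else 0) x y = 0 →
      blockSum P (fun i j => if (t, i, j) ∈ M' then 1 else 0) x y = 0 := by
    intro M M' x y hMM h
    have a := (hv M x y).2
    have b := (hv M' x y).1
    rw [h, hMM, mul_zero] at a
    have := hn M' x y
    -- Since ε < 1, a (1 ± ε)-estimate vanishes only when the value does.
    nlinarith
  refine card_mismatch_le hP hk (fun i j => if (t, i, j) ∈ M then 1 else 0)
    (fun i j => if (t, i, j) ∈ M' then 1 else 0) (fun x y => ?_)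
    (fun x y => ⟨hz M M' x y hMM, hz M' M x y hMM.symm⟩) _ fun p hp => ?_
  · have a := hv M x y
    have b := hv M' x y
    rw [show A.sk (blockGraph φ M) = A.sk (blockGraph φ M') from hMM] at a
    have c := mul_le_mul_of_nonneg_left (hl M x y) hε0.le
    have d := mul_le_mul_of_nonneg_left (hl M' x y) hε0.le
    exact abs_le.2 ⟨by linarith [a.2, b.1], by linarith [a.1, b.2]⟩
  · have := (Finset.mem_filter.1 hp).2
    rw [Finset.mem_symmDiff] at this
    rcases this with ⟨h1, h2⟩ | ⟨h1, h2⟩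
    · right; simp [h1, h2]
    · left; simp [h1, h2]

/-- A sparsifier of a union of complete bipartite blocks keeps most of the edges. -/
theorem card_block_le_card_sparsifier [Fintype β] [DecidableEq β] [DecidableEq V]
    (φ : (β × Fin k) ⊕ (β × Fin k) ↪ V) {P : BoolPred}
    (hP : HasBilinearPart P) {ε : ℝ} (hε0 : 0 < ε) (hε1 : ε < 1)
    (hk : ε * √k ≤ 1 / 144 ∨ k = 1) (H : WDigraph V)
    (hH : WDigraph.IsSparsifier P ε (blockGraph φ Finset.univ) H) :
    Fintype.card β * k ^ 2 ≤ 4 * H.edges.card := by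
  have hcard : Fintype.card (β × Fin k × Fin k) = Fintype.card β * k ^ 2 := by simp [sq]
  let D : Finset (β × Fin k × Fin k) :=
    Finset.univ.filter fun p => blockEdge φ p ∉ H.edges
  have hDc : (Dᶜ).card ≤ H.edges.card := by
    rw [← Finset.card_map (blockEdge φ)]
    refine Finset.card_le_card fun e he => ?_
    obtain ⟨p, hp, rfl⟩ := Finset.mem_map.1 he
    simpa [D] using hp
  have hD : 8 * D.card ≤ Fintype.card β * k ^ 2 := by
    refine card_le_of_card_fibres_le _ _ fun t => ?_
    obtain ⟨x₀, y₀, h₀⟩ := hP.1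
    set W : Fin k → Fin k → ℝ := fun i j => H.weight (blockEdge φ (t, i, j)) with hW
    have hv : ∀ x y, blockSum P W x y ∈ Set.Icc ((1 - ε) * blockSum P (fun _ _ => 1) x y)
        ((1 + ε) * blockSum P (fun _ _ => 1) x y) := by
      intro x y
      have := hH.2 (blockSet φ t x y x₀ y₀)
      rw [value_blockSet φ h₀ hH.1, value_blockSet φ h₀ (Finset.Subset.refl _)] at this
      simpa only [blockGraph_weight, Finset.mem_univ, if_true] using this
    have hn : ∀ x y, 0 ≤ blockSum P (fun _ _ : Fin k => 1) x y :=
      blockSum_nonneg fun _ _ => zero_le_one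
    refine card_mismatch_le hP hk (fun _ _ => 1) W (fun x y => ?_) (fun x y => ⟨fun h => ?_,
      fun h => ?_⟩) _ fun p hp => Or.inr ⟨rfl, ?_⟩
    · have a := hv x y
      have c := mul_le_mul_of_nonneg_left
        (blockSum_le_sq (P := P) (W := fun _ _ : Fin k => 1) (fun _ _ => le_rfl) x y) hε0.le
      have d : 0 ≤ ε * (k : ℝ) ^ 2 := by positivity
      exact abs_le.2 ⟨by linarith [a.2], by linarith [a.1]⟩
    · have a := hv x y
      rw [h, mul_zero, mul_zero] at a
      exact le_antisymm a.2 a.1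
    · have a := (hv x y).1
      rw [h] at a
      have := hn x y
      nlinarith
    · have := (Finset.mem_filter.1 hp).2
      exact H.weight_eq_zero _ (Finset.mem_filter.1 this).2
  have := Finset.card_add_card_compl D
  omega

end Blocks

/-! ### Choice of parameters and conclusion -/

/-- Block parameters for `n` vertices and precision `ε`. -/
theorem exists_block_size {n : ℕ} {ε : ℝ} (hn : 1 ≤ n) (hε : ε ∈ Set.Ioo (1 / √n) 1) :
    ∃ b k : ℕ, b * k + b * k ≤ n ∧ (ε * √k ≤ 1 / 144 ∨ k = 1) ∧
      1 / 1000000 * (n / ε ^ 2) * 4 ≤ ((b * k ^ 2 : ℕ) : ℝ) := by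
  have hn0 : (0 : ℝ) < n := by exact_mod_cast hn
  have hε0 : 0 < ε := lt_trans (by positivity) hε.1
  have hnε : 1 < n * ε ^ 2 := by
    have h1 : 1 < ε * √n := (div_lt_iff₀ (Real.sqrt_pos.2 hn0)).1 hε.1
    calc (1 : ℝ) < (ε * √n) ^ 2 := one_lt_pow₀ h1 two_ne_zero
      _ = n * ε ^ 2 := by rw [mul_pow, Real.sq_sqrt hn0.le, mul_comm]
  have hn2 : 2 ≤ n := by
    by_contra h
    have : n = 1 := by omega
    subst this
    have := hε.2
    have := pow_lt_one₀ hε0.le this two_ne_zero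
    rw [Nat.cast_one, one_mul] at hnε
    linarith
  -- For ε ≤ 1/144, k is the floor of 1/(144ε)², and rounding loses at most a factor 2 (41472 = 2 ·
  -- 144²). For larger ε no k ≥ 1 has ε√k ≤ 1/144, hence single edges.
  obtain ⟨k, hk1, hkn, hkε, hk⟩ : ∃ k : ℕ, 1 ≤ k ∧ 2 * k ≤ n ∧
      (ε * √k ≤ 1 / 144 ∨ k = 1) ∧ 1 ≤ 41472 * ((k : ℝ) * ε ^ 2) := by
    rcases le_or_gt ε (1 / 144) with h | h
    · have hinv : 1 ≤ 1 / (20736 * ε ^ 2) := by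
        rw [one_le_div (by positivity)]
        nlinarith
      have hle := Nat.floor_le (zero_le_one.trans hinv)
      have hlt := Nat.lt_floor_add_one (1 / (20736 * ε ^ 2))
      have hone : 1 ≤ ⌊1 / (20736 * ε ^ 2)⌋₊ := Nat.one_le_floor_iff _ |>.2 hinv
      generalize ⌊1 / (20736 * ε ^ 2)⌋₊ = k at hle hlt hone
      have hone' : (1 : ℝ) ≤ k := by exact_mod_cast hone
      rw [le_div_iff₀ (by positivity)] at hle
      rw [div_lt_iff₀ (by positivity)] at hlt
      refine ⟨k, hone, ?_, Or.inl ?_, by nlinarith [sq_nonneg ε]⟩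
      · have : (2 * k : ℝ) ≤ n := by
          by_contra hc
          have := mul_le_mul_of_nonneg_right (not_le.1 hc).le (sq_nonneg ε)
          linarith
        exact_mod_cast this
      · refine abs_le_of_sq_le_sq' ?_ (by norm_num) |>.2
        rw [mul_pow, Real.sq_sqrt (Nat.cast_nonneg _)]
        linarith
    · refine ⟨1, le_rfl, hn2, Or.inr rfl, ?_⟩
      have := mul_self_le_mul_self (by norm_num) h.le
      norm_num at this ⊢
      nlinarith
  refine ⟨n / (2 * k), k, ?_, hkε, ?_⟩
  · have := Nat.div_mul_le_self n (2 * k)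
    linarith
  -- As 2k ≤ n, rounding n/(2k) down at most halves it, so bk ≥ n/4. The final constant is 1/(4 · 4
  -- · 41472) > 10⁻⁶.
  · have hb : n ≤ 4 * (n / (2 * k) * k) := by
      have h1 := Nat.lt_div_mul_add (a := n) (b := 2 * k) (by omega)
      have h2 : 1 ≤ n / (2 * k) := (Nat.one_le_div_iff (by omega)).2 hkn
      nlinarith
    have hb' : (n : ℝ) ≤ 4 * ((n / (2 * k) : ℕ) * k) := by exact_mod_cast hb
    rw [mul_div_assoc', mul_comm, mul_div_assoc', div_le_iff₀ (by positivity)]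
    push_cast
    have h3 := mul_le_mul hb' hk (by norm_num) (by positivity)
    generalize ((n / (2 * k) : ℕ) : ℝ) = b at *
    have : 0 ≤ b * k ^ 2 * ε ^ 2 := by nlinarith
    nlinarith

theorem mainTheorem4 :
    ∃ c : ℝ, 0 < c ∧
      ∀ P ∈ ({predCut, predUnCut, predOr, predNAnd, predNot10} : Set BoolPred),
      ∀ (n : ℕ) (ε : ℝ), 1 ≤ n → ε ∈ Set.Ioo (1 / Real.sqrt n) 1 →
        (∀ C : Set (WDigraph (Fin n)), WDigraph.simpleUnweighted (Fin n) ⊆ C →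
          ∀ A : SketchingScheme (Fin n), A.IsSketchFor P ε C →
            ENNReal.ofReal (c * (n / ε ^ 2)) ≤ ((A.size C : ℕ∞) : ℝ≥0∞)) ∧
        (∃ G ∈ WDigraph.simpleUnweighted (Fin n),
          ∀ H : WDigraph (Fin n), WDigraph.IsSparsifier P ε G H →
            c * (n / ε ^ 2) ≤ (H.edges.card : ℝ)) := by
  refine ⟨1 / 1000000, by norm_num, fun P hP n ε hn hε => ?_⟩
  have hP := hasBilinearPart_of_mem hP
  have hε0 : 0 < ε := lt_of_le_of_lt (by positivity) hε.1
  obtain ⟨b, k, hbk, hk, hc⟩ := exists_block_size hn hε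
  obtain ⟨φ⟩ : Nonempty ((Fin b × Fin k) ⊕ (Fin b × Fin k) ↪ Fin n) :=
    Function.Embedding.nonempty_of_card_le (by simpa using hbk)
  refine ⟨fun C hC A hA => ?_, blockGraph φ Finset.univ, blockGraph_mem_simpleUnweighted φ _,
    fun H hH => ?_⟩
  · rcases eq_or_ne (A.size C) ⊤ with htop | htop
    · simp [htop]
    obtain ⟨s, hs⟩ := ENat.ne_top_iff_exists.1 htop
    have hle := card_block_le_four_mul_sketch φ hP hε0 hε.2 hk A (fun G hG => hA G (hC hG)) s
      fun G hG => by
        have : ((A.sk G).length : ℕ∞) ≤ A.size C :=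
          le_iSup₂ (f := fun G (_ : G ∈ C) => ((A.sk G).length : ℕ∞)) G (hC hG)
        rw [← hs] at this
        exact_mod_cast this
    rw [Fintype.card_fin] at hle
    have hle' : ((b * k ^ 2 : ℕ) : ℝ) ≤ 4 * s := by exact_mod_cast hle
    rw [← hs, ENat.toENNReal_coe, ENNReal.ofReal_le_natCast]
    linarith
  · have hle := card_block_le_card_sparsifier φ hP hε0 hε.2 hk H hH
    rw [Fintype.card_fin] at hle
    have hle' : ((b * k ^ 2 : ℕ) : ℝ) ≤ 4 * H.edges.card := by exact_mod_cast hle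
    linarith
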